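/- Let $\Sigma$ be a finite alphabet. For a word $w\in\Sigma^*$ let $\mathsf{Facs}(w)$ be the set of its factors (contiguous subwords), and let $\mathfrak{A}_w$ be the structure with universe $\mathsf{Facs}(w)\cup\{\perp\}$, with the ternary relation $\{(x,y,z)\in\mathsf{Facs}(w)^3 \mid x=y\cdot z\}$, with a constant for the empty word $\varepsilon$ (interpreted by $\varepsilon$), and with a constant for each letter $c\in\Sigma$, interpreted by $c$ if $c$ occurs in $w$ and by $\perp$ otherwise. For $k\in\mathbb{N}$ write $w\equiv_k v$ if Duplicator has a winning strategy in the $k$-round Ehrenfeucht–Fraïssé game on $\mathfrak{A}_w$ and $\mathfrak{A}_v$: in each round Spoiler picks an element of one of the two structures and Duplicator answers with an element of the other one, and Duplicator wins if after $k$ rounds the chosen elements, together with the interpretations of all constants, define a partial isomorphism (equalities, also with constants, and the concatenation relation are preserved in both directions). **Proposition.** Let $\mathtt{a},\mathtt{b}\in\Sigma$ be distinct letters. For every $k\ge 5$ the relation $\equiv_k$ is not a congruence on $\Sigma^*$, that is, it is not true that $u\equiv_k v$ and $u'\equiv_k v'$ always imply $u u'\equiv_k v v'$. More precisely, for every $k\ge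 5$ there are $p,q\in\mathbb{N}$ with $p\neq q$ such that, for $u=\mathtt{a}^p$, $v=\mathtt{a}^q$ and $u'=v'=\mathtt{b}\mathtt{a}^p$, $$u\equiv_k v,\qquad u'\equiv_k v',\qquad\text{but}\qquad u u'=\mathtt{a}^p\mathtt{b}\mathtt{a}^p\not\equiv_k \mathtt{a}^q\mathtt{b}\mathtt{a}^p=v v'.$$ -/

import Mathlib

namespace FCGame

universe u t

/-- `Facs w`: the set of all factors (contiguous subwords) of the word `w`. -/
def Facs {α : Type u} (w : List α) : Set (List α) := {x | x <:+: w}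

/-- The constant symbols of the signature: one for every letter, and one for the empty word. -/
inductive ConstSymbol (α : Type u) : Type u
  | letter (a : α) : ConstSymbol α
  | eps : ConstSymbol α

/-- The universe `Facs w ∪ {⊥}` of the structure that represents `w`; `none` is the null
value `⊥`. -/
abbrev Univ {α : Type u} (w : List α) : Type u := Option (Facs w)

/-- The interpretation of the constant symbols in the structure that represents `w`: a letter
that occurs in `w` denotes the one-letter factor, a letter that does not occur denotes `⊥`, and
`eps` denotes the empty word. -/
noncomputable def constInterp {α : Type u} (w : List α) : ConstSymbol α → Univ w
  | .letter a => by
      classical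
      exact if h : a ∈ w then some ⟨[a], (List.singleton_infix_iff a w).mpr h⟩ else none
  | .eps => some ⟨[], List.nil_infix⟩

/-- The ternary relation of the structure that represents `w`: `concatRel w x y z` holds when
`x`, `y`, `z` are factors of `w` (so none of them is `⊥`) with `x = y · z`. -/
def concatRel {α : Type u} (w : List α) (x y z : Univ w) : Prop :=
  ∃ r s t : Facs w, x = some r ∧ y = some s ∧ z = some t ∧ (r : List α) = s ++ t

/-- The tuples `x` and `y` (over the same index set) define a partial isomorphism between the
structures that represent `w` and `v`. -/
structure IsPartialIso {α : Type u} (w v : List α) {ι : Type t}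
    (x : ι → Univ w) (y : ι → Univ v) : Prop where
  const_iff : ∀ (i : ι) (c : ConstSymbol α), x i = constInterp w c ↔ y i = constInterp v c
  eq_iff : ∀ i j : ι, x i = x j ↔ y i = y j
  concat_iff : ∀ i j k : ι, concatRel w (x i) (x j) (x k) ↔ concatRel v (y i) (y j) (y k)

/-- The tuple of the chosen elements, extended by the interpretations of all constants. -/
noncomputable def withConsts {α : Type u} (w : List α) {n : ℕ} (x : Fin n → Univ w) :
    Fin n ⊕ ConstSymbol α → Univ w :=
  Sum.elim x (constInterp w)

/-- Duplicator has a winning strategy for the Ehrenfeucht-Fraisse game on the structures that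
represent `w` and `v` with `k` rounds still to be played, when `x` and `y` are the elements chosen
so far. In each round Spoiler picks one of the structures and an element of it, and Duplicator
answers with an element of the other one. When no round is left, Duplicator has won if and only
if the chosen elements together with the constants define a partial isomorphism. -/
def DuplicatorWins {α : Type u} (w v : List α) :
    (k : ℕ) → {n : ℕ} → (Fin n → Univ w) → (Fin n → Univ v) → Prop
  | 0, _, x, y => IsPartialIso w v (withConsts w x) (withConsts v y)
  | k + 1, n, x, y =>
      (∀ a : Univ w, ∃ b : Univ v, DuplicatorWins w v k
        (Fin.snoc (α := fun _ : Fin (n + 1) => Univ w) x a)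
        (Fin.snoc (α := fun _ : Fin (n + 1) => Univ v) y b)) ∧
      (∀ b : Univ v, ∃ a : Univ w, DuplicatorWins w v k
        (Fin.snoc (α := fun _ : Fin (n + 1) => Univ w) x a)
        (Fin.snoc (α := fun _ : Fin (n + 1) => Univ v) y b))

/-- `w ≡_k v`: Duplicator has a winning strategy for the `k`-round game, starting with no chosen
elements. -/
def EFEquiv {α : Type u} (k : ℕ) (w v : List α) : Prop :=
  DuplicatorWins w v k (n := 0) Fin.elim0 Fin.elim0

/-- A binary relation on words is a congruence relation if it is compatible with
concatenation. -/
def IsCongruenceRel {α : Type u} (R : List α → List α → Prop) : Prop :=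
  ∀ w v w' v' : List α, R w v → R w' v' → R (w ++ w') (v ++ v')

end FCGame

namespace FCGame

universe u

/-! Over a finite alphabet `≡_k` has finite index (`exists_finite_type`), so by pigeonhole two
distinct powers of `a` are equivalent. Five rounds suffice for Spoiler to test whether the whole
word has the form `s · b · s` (`EFEquiv.exists_eq_append`): three moves exhibit `s`, `s · b` and `s
· b · s`, and two more show that the last is not a proper factor. Since `a^q b a^p` contains a
single `b`, it has this form only if `p = q`. -/

theorem IsPartialIso.comp {α : Type u} {w v : List α} {ι κ : Type*} {x : ι → Univ w}
    {y : ι → Univ v} (h : IsPartialIso w v x y) (f : κ → ι) :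
    IsPartialIso w v (x ∘ f) (y ∘ f) :=
  ⟨fun i c => h.const_iff (f i) c, fun i j => h.eq_iff (f i) (f j),
    fun i j k => h.concat_iff (f i) (f j) (f k)⟩

theorem withConsts_snoc_comp {α : Type u} (w : List α) {n : ℕ} (x : Fin n → Univ w)
    (c : Univ w) :
    withConsts w (Fin.snoc (α := fun _ : Fin (n + 1) => Univ w) x c) ∘ Sum.map Fin.castSucc id =
      withConsts w x := by
  funext i
  rcases i with i | i
  · simp [withConsts]
  · rfl

/-- A position that is won by Duplicator is a partial isomorphism, whatever the number of
remaining rounds. -/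
theorem DuplicatorWins.isPartialIso {α : Type u} {w v : List α} {k : ℕ} :
    ∀ {n : ℕ} {x : Fin n → Univ w} {y : Fin n → Univ v}, DuplicatorWins w v k x y →
      IsPartialIso w v (withConsts w x) (withConsts v y) := by
  induction k with
  | zero => exact fun h => h
  | succ k ih =>
    intro n x y h
    -- Any legal move would do; `⊥` is always available, and the added coordinate is then forgotten.
    obtain ⟨c, hc⟩ := h.1 none
    have := (ih hc).comp (Sum.map Fin.castSucc id)
    rwa [withConsts_snoc_comp, withConsts_snoc_comp] at this

theorem DuplicatorWins.refl {α : Type u} (w : List α) (k : ℕ) :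
    ∀ {n : ℕ} (x : Fin n → Univ w), DuplicatorWins w w k x x := by
  induction k with
  | zero => exact fun _ => ⟨fun _ _ => Iff.rfl, fun _ _ => Iff.rfl, fun _ _ _ => Iff.rfl⟩
  | succ k ih => exact fun x => ⟨fun c => ⟨c, ih _⟩, fun c => ⟨c, ih _⟩⟩

theorem EFEquiv.refl {α : Type u} (k : ℕ) (w : List α) : EFEquiv k w w :=
  DuplicatorWins.refl w k _

instance {α : Type u} [Finite α] : Finite (ConstSymbol α) :=
  Finite.of_surjective (fun o : Option α => o.elim ConstSymbol.eps ConstSymbol.letter) fun c => by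
    cases c with
    | letter a => exact ⟨some a, rfl⟩
    | eps => exact ⟨none, rfl⟩

/-- Over a finite alphabet, positions with `k` remaining rounds have finitely many types, and
Duplicator wins between positions of equal type. -/
theorem exists_finite_type {α : Type u} [Finite α] (k : ℕ) :
    ∀ n : ℕ, ∃ (T : Type u) (_ : Finite T) (f : (w : List α) → (Fin n → Univ w) → T),
      ∀ w v x y, f w x = f v y → DuplicatorWins w v k x y := by
  induction k with
  | zero =>
    intro n
    let ι := Fin n ⊕ ConstSymbol α
    refine ⟨(ι → ConstSymbol α → Prop) × (ι → ι → Prop) × (ι → ι → ι → Prop), inferInstance,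
      fun w x => (fun i c => withConsts w x i = constInterp w c,
        fun i j => withConsts w x i = withConsts w x j,
        fun i j k => concatRel w (withConsts w x i) (withConsts w x j) (withConsts w x k)), ?_⟩
    intro w v x y h
    simp only [Prod.mk.injEq] at h
    obtain ⟨h₁, h₂, h₃⟩ := h
    exact ⟨fun i c => iff_of_eq (congrFun₂ h₁ i c), fun i j => iff_of_eq (congrFun₂ h₂ i j),
      fun i j k => iff_of_eq (congrFun (congrFun₂ h₃ i j) k)⟩
  | succ k ih =>
    intro n
    obtain ⟨T, hT, f, hf⟩ := ih (n + 1)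
    -- The type of a position is the set of types reachable from it in one move.
    refine ⟨Set T, inferInstance, fun w x => Set.range fun c : Univ w =>
      f w (Fin.snoc (α := fun _ : Fin (n + 1) => Univ w) x c), ?_⟩
    intro w v x y h
    refine ⟨fun c => ?_, fun d => ?_⟩
    · obtain ⟨d, hd⟩ := h.subset (Set.mem_range_self c)
      exact ⟨d, hf _ _ _ _ hd.symm⟩
    · obtain ⟨c, hc⟩ := h.superset (Set.mem_range_self d)
      exact ⟨c, hf _ _ _ _ hc⟩

theorem exists_ne_efEquiv {α : Type u} [Finite α] (k : ℕ) (g : ℕ → List α) :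
    ∃ p q : ℕ, p ≠ q ∧ EFEquiv k (g p) (g q) := by
  obtain ⟨T, hT, f, hf⟩ := exists_finite_type (α := α) k 0
  obtain ⟨p, q, hpq, h⟩ := Finite.exists_ne_map_eq_of_infinite fun n => f (g n) Fin.elim0
  exact ⟨p, q, hpq, hf _ _ _ _ h⟩

/-- The only `b` on the right is at index `q`, so `s` has length `q`; comparing total lengths gives
`p = q`. -/
theorem eq_of_replicate_append_eq {α : Type u} {a b : α} (hab : a ≠ b) {p q : ℕ} {s : List α}
    (h : s ++ [b] ++ s = List.replicate q a ++ ([b] ++ List.replicate p a)) : p = q := by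
  have hlen := congrArg List.length h
  have hget := congrArg (fun l => l[s.length]?) h
  simp only [List.length_append, List.length_replicate, List.length_singleton] at hlen
  rcases lt_trichotomy s.length q with hs | hs | hs
  · simp [List.getElem?_append, hs, hab.symm] at hget
  · omega
  · obtain ⟨d, hd⟩ : ∃ d, s.length = q + 1 + d := ⟨_, (Nat.add_sub_of_le hs).symm⟩
    have : d < p := by omega
    have e : ¬ q + 1 + d < q := by omega
    have e' : q + 1 + d - q = d + 1 := by omega
    simp [List.getElem?_append, hd, e, e', this, hab.symm] at hget

/-- A whole word `s · c · s` cannot be matched by a proper factor of that form when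
five rounds are played, so being of the form `s · c · s` is preserved by `≡_k` for `k ≥ 5`. -/
theorem EFEquiv.exists_eq_append {α : Type u} {b : α} {k : ℕ} {s v : List α}
    (h : EFEquiv (k + 5) (s ++ [b] ++ s) v) : ∃ s', v = s' ++ [b] ++ s' := by
  set w := s ++ [b] ++ s with hw
  let x : Univ w := some ⟨s, ⟨[], [b] ++ s, by simp [hw]⟩⟩
  let y : Univ w := some ⟨s ++ [b], ⟨[], s, by simp [hw]⟩⟩
  let z : Univ w := some ⟨w, List.infix_rfl⟩
  obtain ⟨x', hx⟩ := h.1 x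
  obtain ⟨y', hy⟩ := hx.1 y
  obtain ⟨z', hz⟩ := hy.1 z
  have hb : b ∈ w := by simp [hw]
  have h₁ := (hz.isPartialIso.concat_iff (Sum.inl 1) (Sum.inl 0) (Sum.inr (.letter b))).1
    ⟨_, _, _, rfl, rfl, by simp only [withConsts, Sum.elim_inr, constInterp, dif_pos hb]; rfl, rfl⟩
  have h₂ := (hz.isPartialIso.concat_iff (Sum.inl 2) (Sum.inl 1) (Sum.inl 0)).1
    ⟨_, _, _, rfl, rfl, rfl, rfl⟩
  change concatRel v y' x' (constInterp v (.letter b)) at h₁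
  change concatRel v z' y' x' at h₂
  obtain ⟨y₁, x₁, b₁, ey, ex, eb, e₁⟩ := h₁
  obtain ⟨z₁, y₂, x₂, ez, ey', ex', e₂⟩ := h₂
  obtain rfl : y₁ = y₂ := Option.some.inj (ey.symm.trans ey')
  obtain rfl : x₁ = x₂ := Option.some.inj (ex.symm.trans ex')
  -- The concatenation relation excludes `⊥`, so `b` must occur in `v`.
  have eb' : (b₁ : List α) = [b] := by
    by_cases hv : b ∈ v
    · simp only [constInterp, dif_pos hv, Option.some.injEq] at eb
      rw [← eb]
    · simp [constInterp, hv] at eb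
  rw [e₁, eb'] at e₂
  obtain ⟨l, r, hlr⟩ := z₁.2
  have hl : l = [] := by
    -- Spoiler plays `l` and `l · z₁` in `v`. The replies would prepend a factor to the whole word
    -- `w` inside `w`, so the reply to `l` is empty, and hence so is `l`.
    let l₁ : Facs v := ⟨l, ⟨[], z₁ ++ r, by simpa using hlr⟩⟩
    let m₁ : Facs v := ⟨l ++ z₁, ⟨[], r, by simpa using hlr⟩⟩
    obtain ⟨l', hl'⟩ := hz.2 (some l₁)
    obtain ⟨m', hm⟩ := hl'.2 (some m₁)
    have h₃ := (hm.isPartialIso.concat_iff (Sum.inl 4) (Sum.inl 3) (Sum.inl 2)).2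
      ⟨m₁, l₁, z₁, rfl, rfl, ez, rfl⟩
    change concatRel w m' l' z at h₃
    obtain ⟨m₂, l₂, z₂, -, el, ez', e₃⟩ := h₃
    have hlen := m₂.2.length_le
    obtain rfl := Option.some.inj ez'
    simp only [e₃, List.length_append, add_le_iff_nonpos_left, nonpos_iff_eq_zero,
      List.length_eq_zero_iff] at hlen
    have h₄ := (hm.isPartialIso.const_iff (Sum.inl 3) .eps).1
      (el.trans (congrArg some (Subtype.ext hlen)))
    change some l₁ = some _ at h₄
    exact congrArg Subtype.val (Option.some.inj h₄)
  have hr : r = [] := by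
    -- The mirror image, as an alternative use of the last two rounds.
    let r₁ : Facs v := ⟨r, ⟨l ++ z₁, [], by simpa using hlr⟩⟩
    let m₁ : Facs v := ⟨z₁ ++ r, ⟨l, [], by simpa using hlr⟩⟩
    obtain ⟨r', hr'⟩ := hz.2 (some r₁)
    obtain ⟨m', hm⟩ := hr'.2 (some m₁)
    have h₃ := (hm.isPartialIso.concat_iff (Sum.inl 4) (Sum.inl 2) (Sum.inl 3)).2
      ⟨m₁, z₁, r₁, rfl, ez, rfl, rfl⟩
    change concatRel w m' z r' at h₃
    obtain ⟨m₂, z₂, r₂, -, ez', er, e₃⟩ := h₃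
    have hlen := m₂.2.length_le
    obtain rfl := Option.some.inj ez'
    simp only [e₃, List.length_append, add_le_iff_nonpos_right, nonpos_iff_eq_zero,
      List.length_eq_zero_iff] at hlen
    have h₄ := (hm.isPartialIso.const_iff (Sum.inl 3) .eps).1
      (er.trans (congrArg some (Subtype.ext hlen)))
    change some r₁ = some _ at h₄
    exact congrArg Subtype.val (Option.some.inj h₄)
  subst hl hr
  exact ⟨x₁, by simpa [e₂] using hlr.symm⟩

end FCGame

theorem mainTheorem10 {α : Type*} [Finite α] (a b : α) (hab : a ≠ b) (k : ℕ) (hk : 5 ≤ k) :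
    ¬ FCGame.IsCongruenceRel (FCGame.EFEquiv (α := α) k) ∧
    ∃ p q : ℕ, p ≠ q ∧
      FCGame.EFEquiv k (List.replicate p a) (List.replicate q a) ∧
      FCGame.EFEquiv k ([b] ++ List.replicate p a) ([b] ++ List.replicate p a) ∧
      ¬ FCGame.EFEquiv k
        (List.replicate p a ++ ([b] ++ List.replicate p a))
        (List.replicate q a ++ ([b] ++ List.replicate p a)) := by
  obtain ⟨p, q, hpq, h⟩ := FCGame.exists_ne_efEquiv k fun n => List.replicate n a
  have hrefl := FCGame.EFEquiv.refl k ([b] ++ List.replicate p a)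
  have hne : ¬ FCGame.EFEquiv k (List.replicate p a ++ ([b] ++ List.replicate p a))
      (List.replicate q a ++ ([b] ++ List.replicate p a)) := by
    obtain ⟨k, rfl⟩ := Nat.exists_eq_add_of_le' hk
    intro h'
    rw [← List.append_assoc (List.replicate p a)] at h'
    obtain ⟨s, hs⟩ := h'.exists_eq_append
    exact hpq (FCGame.eq_of_replicate_append_eq hab hs.symm)
  exact ⟨fun hc => hne (hc _ _ _ _ h hrefl), p, q, hpq, h, hrefl, hne⟩
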